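/- Define $A,B:\mathbb N\times\mathbb N\to\mathbb N$ by $A(0,j)=2j$, $A(i,0)=1$ for $i\ge1$, $A(i,j)=A(i-1,A(i,j-1))$ for $i,j\ge 1$, and $B(0,j)=j^2$, $B(i,0)=2$ for $i\ge1$, $B(i,j)=B(i-1,B(i,j-1))$ for $i,j\ge1$. For $i\ge 0$ let $\lambda_{2i}(n)=\min\{j: A(i,j)\ge n\}$ and $\lambda_{2i+1}(n)=\min\{j: B(i,j)\ge n\}$, and let $\alpha(n)=\min\{j: A(j,j)\ge n\}$. Let $G=(V,E,w)$ be a finite undirected simple graph with nonnegative real edge weights, and let $n=|V|$. Let $d_G(u,v)$ be the shortest-path distance ($\infty$ if $u$ and $v$ are not connected), and let $d_G^h(u,v)$ be the least length of a path from $u$ to $v$ with at most $h$ edges ($\infty$ if there is none). An exact $h$-hopset for $G$ is a set $H$ of edges on $V$ (pairs of distinct vertices) such that $d^h_{G\cup H}(u,v)=d_G(u,v)$ for all $u,v\in V$, where $G\cup H=(V,E\cup H,w')$ with $w'(uv)=d_G(u,v)$ for $uv\in H$ and $w'(uv)=w(uv)$ for $uv\in E\setminus H$. The graph $G$ has treewidth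 (at most) $t$ if there is a finite tree $T$ whose nodes carry subsets of $V$ (bags) such that every bag has at most $t+1$ elements, every edge of $G$ has both endpoints in some bag, and for every $u\in V$ the nodes of $T$ whose bag contains $u$ form a nonempty subtree of $T$. There is an absolute constant $C$ such that every such graph $G$ with $n$ vertices and treewidth at most $t$ satisfies: 1. for every integer $h>1$, $G$ has an exact $h$-hopset with at most $C\,t\,n\,\lambda_h(n)$ edges; 2. $G$ has an exact $2(\alpha(n)+1)$-hopset with at most $C\,t^2\,n$ edges. -/

import Mathlib

open scoped NNReal ENNReal

namespace Hopset

/-! ### Ackermann-type functions and their inverses -/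

/-- `A(0,j) = 2j`, `A(i,0) = 1` for `i ≥ 1`, `A(i,j) = A(i-1, A(i,j-1))` for `i, j ≥ 1`. -/
def ackA : ℕ → ℕ → ℕ
  | 0, j => 2 * j
  | _ + 1, 0 => 1
  | i + 1, j + 1 => ackA i (ackA (i + 1) j)
  termination_by i j => (i, j)

/-- `B(0,j) = j²`, `B(i,0) = 2` for `i ≥ 1`, `B(i,j) = B(i-1, B(i,j-1))` for `i, j ≥ 1`. -/
def ackB : ℕ → ℕ → ℕ
  | 0, j => j ^ 2
  | _ + 1, 0 => 2
  | i + 1, j + 1 => ackB i (ackB (i + 1) j)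
  termination_by i j => (i, j)

theorem lt_ackA (i : ℕ) : ∀ j, 1 ≤ i ∨ 1 ≤ j → j < ackA i j := by
  induction i with
  | zero => intro j hj; rw [ackA]; omega
  | succ i ih =>
    intro j _
    induction j with
    | zero => rw [ackA]; omega
    | succ j jh =>
      have h1 := jh (Or.inl (by omega))
      have h2 := ih (ackA (i + 1) j) (Or.inr (by omega))
      rw [ackA]; omega

theorem lt_ackB (i : ℕ) : ∀ j, 1 ≤ i ∨ 2 ≤ j → j < ackB i j ∧ 2 ≤ ackB i j := by
  induction i with
  | zero =>
    intro j hj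
    have hj2 : 2 ≤ j := by omega
    rw [ackB]
    constructor <;> nlinarith
  | succ i ih =>
    intro j _
    induction j with
    | zero => rw [ackB]; omega
    | succ j jh =>
      have h1 := jh (Or.inl (by omega))
      have h2 := ih (ackB (i + 1) j) (Or.inr h1.2)
      rw [ackB]; omega

theorem exists_le_ackA (i n : ℕ) : ∃ j, n ≤ ackA i j :=
  ⟨n + 1, by have := lt_ackA i (n + 1) (Or.inr (by omega)); omega⟩

theorem exists_le_ackB (i n : ℕ) : ∃ j, n ≤ ackB i j :=
  ⟨n + 2, by have := lt_ackB i (n + 2) (Or.inr (by omega)); omega⟩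

theorem exists_le_ackA_diag (n : ℕ) : ∃ j, n ≤ ackA j j :=
  ⟨n + 1, by have := lt_ackA (n + 1) (n + 1) (Or.inr (by omega)); omega⟩

/-- The `k`-th row inverse Ackermann function `λ_k`:
`λ_{2i}(n) = min {j | A(i,j) ≥ n}` and `λ_{2i+1}(n) = min {j | B(i,j) ≥ n}`. -/
def rowInvAck (k n : ℕ) : ℕ :=
  if k % 2 = 0 then Nat.find (exists_le_ackA (k / 2) n)
  else Nat.find (exists_le_ackB (k / 2) n)

/-- The inverse Ackermann function `α(n) = min {j | A(j,j) ≥ n}`. -/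
def invAck (n : ℕ) : ℕ := Nat.find (exists_le_ackA_diag n)

/-! ### Distances in weighted graphs and exact hopsets -/

variable {V : Type*}

/-- The length of a walk: the sum of the weights of its edges (with multiplicity).
Only the values of `w` on edges of `G` matter. -/
def walkLength {G : SimpleGraph V} (w : Sym2 V → ℝ≥0∞) {u v : V} (p : G.Walk u v) : ℝ≥0∞ :=
  (p.edges.map w).sum

/-- The shortest-path distance; it is `∞` when `u` and `v` lie in different components. -/
noncomputable def wDist (G : SimpleGraph V) (w : Sym2 V → ℝ≥0∞) (u v : V) : ℝ≥0∞ :=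
  ⨅ p : G.Walk u v, walkLength w p

/-- The `h`-limited distance: the least length of a walk with at most `h` edges
(`∞` if there is none). -/
noncomputable def hopDist (G : SimpleGraph V) (w : Sym2 V → ℝ≥0∞) (h : ℕ) (u v : V) : ℝ≥0∞ :=
  ⨅ p : {p : G.Walk u v // p.length ≤ h}, walkLength w p.1

theorem wDist_comm (G : SimpleGraph V) (w : Sym2 V → ℝ≥0∞) (u v : V) :
    wDist G w u v = wDist G w v u := by
  have key : ∀ a b : V, wDist G w a b ≤ wDist G w b a := by
    intro a b
    refine le_iInf fun p => (iInf_le _ p.reverse).trans (le_of_eq ?_)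
    simp [walkLength, SimpleGraph.Walk.edges_reverse, List.sum_reverse]
  exact le_antisymm (key u v) (key v u)

open Classical in
/-- The weights of the augmented graph `G ∪ H`: an edge `uv` of `H` has weight `d_G(u,v)`,
an edge of `G` that is not in `H` keeps its weight. -/
noncomputable def augWeight (G : SimpleGraph V) (w : Sym2 V → ℝ≥0∞) (H : SimpleGraph V) :
    Sym2 V → ℝ≥0∞ := fun e =>
  if e ∈ H.edgeSet then Sym2.lift ⟨fun u v => wDist G w u v, fun u v => wDist_comm G w u v⟩ e
  else w e

/-- `H` (a set of edges on the vertex set of `G`, given as a simple graph) is an exact `h`-hopset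
for the graph `G` with the edge weights `w`. -/
def IsExactHopset (G : SimpleGraph V) (w : Sym2 V → ℝ≥0) (h : ℕ) (H : SimpleGraph V) : Prop :=
  ∀ u v : V, hopDist (G ⊔ H) (augWeight G (fun e => (w e : ℝ≥0∞)) H) h u v =
    wDist G (fun e => (w e : ℝ≥0∞)) u v

/-! ### Treewidth -/

/-- The tree `T` with the bags `bag` is a tree decomposition of `G`. -/
structure IsTreeDecomposition (G : SimpleGraph V) {m : ℕ} (T : SimpleGraph (Fin m))
    (bag : Fin m → Finset V) : Prop where
  isTree : T.IsTree
  edge_mem : ∀ u v : V, G.Adj u v → ∃ i, u ∈ bag i ∧ v ∈ bag i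
  /-- The bags containing `u` form a (nonempty) subtree. -/
  subtree : ∀ u : V, (T.induce {i | u ∈ bag i}).Connected

/-- `G` has a tree decomposition all of whose bags have at most `t + 1` elements. -/
def HasTreewidthAtMost (G : SimpleGraph V) (t : ℕ) : Prop :=
  ∃ (m : ℕ) (T : SimpleGraph (Fin m)) (bag : Fin m → Finset V),
    IsTreeDecomposition G T bag ∧ ∀ i, (bag i).card ≤ t + 1

end Hopset

/-! Small separators exist at every scale. With bags of size at most `b = t + 1`, a set `S` of
vertices can be cut by a set `X` with `|X| ≤ 2b|S|/(s+1)` into pieces of at most `s` vertices of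
`S`, each separated from the rest by at most `2b` vertices of `X`
(`IsTreeDecomposition.exists_isCut`). This comes from a greedy leaf-to-root partition of the
decomposition tree (`exists_isPartition`).

A pair not inside one piece has a vertex of `X` metrically between its ends. Attaching each vertex
of `S` to the separator of its piece, and solving the problem on `X` with `k` hops, serves all such
pairs with `k + 2` hops (`IsCut.exists_joinsAcross`). Pairs inside a piece are handled by recursion,
with no extra hops.

Let row `h` bound the size of `S` in units of `8b`. Cutting a set of size `8b · rowAck h q` into
pieces of size `8bq` makes the crossing cost `O(b|S|)`, and taking `q = rowAck (h+2) j` is exactly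
one step of the Ackermann recursion. So `h + 2` hops and `O(b(j+1)|S|)` edges suffice for sizes up
to `8b · rowAck (h+2) j` (`IsTreeDecomposition.exists_joinsAll`). The first claim takes `j =
λ_h(n)`. The second takes `j = 4`, since `n ≤ A(α(n)+1, 4)`; it even gives a bound linear in `t`. -/

namespace Hopset

/-! ### Partitioning a weighted tree -/

section TreePartition

variable {ι : Type*} [DecidableEq ι]

/-- The vertex sets that can be built from a single vertex by repeatedly attaching a leaf. -/
inductive Peelable (T : SimpleGraph ι) : Finset ι → Prop
  | single (r : ι) : Peelable T {r}
  | attach (A : Finset ι) (v p : ι) (hA : Peelable T A) (hv : v ∉ A) (hp : p ∈ A)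
      (hadj : T.Adj v p) (huniq : ∀ a ∈ A, T.Adj v a → a = p) : Peelable T (insert v A)

theorem Peelable.exists_walk {T : SimpleGraph ι} {A : Finset ι} (h : Peelable T A) :
    ∀ a ∈ A, ∀ b ∈ A, ∃ p : T.Walk a b, ∀ x ∈ p.support, x ∈ A := by
  induction h with
  | single r =>
    intro a ha b hb
    rw [Finset.mem_singleton] at ha hb
    subst ha; subst hb
    exact ⟨.nil, by simp⟩
  | attach A v p hA hv hp hadj huniq ih =>
    have key : ∀ a ∈ A, ∃ q : T.Walk v a, ∀ x ∈ q.support, x ∈ insert v A := by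
      intro a ha
      obtain ⟨q, hq⟩ := ih p hp a ha
      refine ⟨.cons hadj q, ?_⟩
      intro x hx
      rw [SimpleGraph.Walk.support_cons, List.mem_cons] at hx
      rcases hx with rfl | hx
      · simp
      · exact Finset.mem_insert_of_mem (hq x hx)
    intro a ha b hb
    rw [Finset.mem_insert] at ha hb
    rcases ha with rfl | ha <;> rcases hb with rfl | hb
    · exact ⟨.nil, by simp⟩
    · exact key b hb
    · obtain ⟨q, hq⟩ := key a ha
      exact ⟨q.reverse, by simpa using hq⟩
    · obtain ⟨q, hq⟩ := ih a ha b hb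
      exact ⟨q, fun x hx => Finset.mem_insert_of_mem (hq x hx)⟩

/-- Connectedness supplies an edge leaving any proper vertex set. A second neighbour inside the set
would give two different paths between the same vertices, contradicting acyclicity. -/
theorem peelable_univ [Fintype ι] {T : SimpleGraph ι} (hT : T.IsTree) :
    Peelable T Finset.univ := by
  have : Nonempty ι := hT.connected.nonempty
  have key : ∀ k, k + 1 ≤ Fintype.card ι → ∃ A : Finset ι, A.card = k + 1 ∧ Peelable T A := by
    intro k
    induction k with
    | zero => exact fun _ => ⟨{Classical.arbitrary ι}, by simp, .single _⟩
    | succ k ih =>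
      intro hk
      obtain ⟨A, hAc, hA⟩ := ih (by omega)
      obtain ⟨r, hr⟩ : A.Nonempty := Finset.card_pos.1 (by omega)
      obtain ⟨x, hx⟩ : ∃ x, x ∉ A := by
        by_contra! hall
        rw [Finset.eq_univ_of_forall hall, Finset.card_univ] at hAc
        omega
      obtain ⟨q⟩ := hT.connected r x
      obtain ⟨e, -, he1, he2⟩ := q.exists_boundary_dart (A : Set ι) hr (by simpa using hx)
      have he1 : e.fst ∈ A := by simpa using he1
      have he2 : e.snd ∉ A := by simpa using he2
      refine ⟨insert e.snd A, by rw [Finset.card_insert_of_notMem he2, hAc],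
        .attach A e.snd e.fst hA he2 he1 e.adj.symm ?_⟩
      intro a ha hadj
      by_contra hne
      obtain ⟨q, hq⟩ := hA.exists_walk e.fst he1 a ha
      have hsup : ∀ x ∈ q.toPath.1.support, x ∈ A :=
        fun x hx => hq x (q.support_toPath_subset_support hx)
      have hp1 : (SimpleGraph.Walk.cons e.adj.symm q.toPath.1).IsPath :=
        (SimpleGraph.Walk.cons_isPath_iff _ _).2 ⟨q.toPath.2, fun h => he2 (hsup _ h)⟩
      have hp2 : (SimpleGraph.Walk.cons hadj .nil).IsPath := by
        simp [SimpleGraph.Walk.cons_isPath_iff, hadj.ne]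
      have := congrArg (fun p : T.Path e.snd a => p.1.support)
        ((hT.isAcyclic.subsingleton_path e.snd a).elim ⟨_, hp1⟩ ⟨_, hp2⟩)
      have hmem : e.fst ∈ (SimpleGraph.Walk.cons hadj (.nil : T.Walk a a)).support := by
        rw [← this]; simp
      simp only [SimpleGraph.Walk.support_cons, SimpleGraph.Walk.support_nil, List.mem_cons,
        List.not_mem_nil, or_false] at hmem
      rcases hmem with h | h
      · exact e.adj.ne h
      · exact hne h.symm
  obtain ⟨A, hAc, hA⟩ := key (Fintype.card ι - 1) (by have := Fintype.card_pos (α := ι); omega)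
  have : A = Finset.univ := by
    rw [← Finset.card_eq_iff_eq_univ, hAc]
    have := Fintype.card_pos (α := ι); omega
  exact this ▸ hA

/-- The vertices in `Y` cut the part `A` of the tree `T` into classes (the fibres of `ℓ`), each of
which has weight at most `s` and is bounded by at most two elements of `Y` and of the sets `η`. -/
structure IsPartition (T : SimpleGraph ι) (A : Finset ι) (ω : ι → ℕ) (η : ι → Finset ι) (s : ℕ)
    (Y : Finset ι) (ℓ : ι → ι) (N : ι → Finset ι) : Prop where
  subset : Y ⊆ A
  label_mem : ∀ a ∈ A, ℓ a ∈ A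
  card_le : ∀ c, (N c).card ≤ 2
  marked : ∀ a ∈ A, a ∉ Y → η a ⊆ N (ℓ a)
  label_eq : ∀ a ∈ A, ∀ b ∈ A, T.Adj a b → a ∉ Y → b ∉ Y → ℓ a = ℓ b
  boundary : ∀ a ∈ A, ∀ b ∈ A, T.Adj a b → a ∉ Y → b ∈ Y → b ∈ N (ℓ a)
  weight_le : ∀ c, ∑ a ∈ A with a ∉ Y ∧ ℓ a = c, ω a ≤ s

/-- Leaves are peeled towards the root. A leaf's accumulated weight `ω v` and its marks `η v` (cut
vertices bordering its unfinished class) are passed to its parent, unless they are too large, in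
which case the leaf is cut and marks its parent. Quantifying over `ω` and `η` lets the induction
carry these accumulated data. A new cut costs `2(s+1)`: `s+1` for the vertex and `s+1` for the new
mark. It is paid by `ω v ≥ s+1` or by two marks that disappear. -/
theorem exists_isPartition {T : SimpleGraph ι} {A : Finset ι} (hA : Peelable T A) (s : ℕ) :
    ∀ (ω : ι → ℕ) (η : ι → Finset ι), ∃ Y ℓ N, IsPartition T A ω η s Y ℓ N ∧
      (s + 1) * Y.card ≤ 2 * ∑ a ∈ A, ω a + (s + 1) * ∑ a ∈ A, (η a).card := by
  induction hA with
  | single r =>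
    intro ω η
    by_cases hbad : s < ω r ∨ 2 < (η r).card
    · refine ⟨{r}, id, fun _ => ∅, ⟨by simp, by simp, by simp, by simp, by simp, by simp, ?_⟩, ?_⟩
      · intro c
        rw [Finset.sum_eq_zero]
        · omega
        · intro x hx
          simp only [Finset.mem_filter] at hx
          exact absurd hx.1 hx.2.1
      · simp only [Finset.card_singleton, Finset.sum_singleton]
        rcases hbad with h | h <;> nlinarith
    · push Not at hbad
      refine ⟨∅, id, fun c => if c = r then η r else ∅,
        ⟨by simp, by simp, ?_, by simp, by simp, by simp, ?_⟩, by simp⟩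
      · intro c
        split_ifs
        · exact hbad.2
        · simp
      · intro c
        exact (Finset.sum_le_sum_of_subset (Finset.filter_subset _ _)).trans (by simpa using hbad.1)
  | attach A v p hA hv hp hadj huniq ih =>
    intro ω η
    have hpv : p ≠ v := fun h => hv (h ▸ hp)
    -- The root tolerated two marks; here only one is allowed, leaving room for `p` as the second
    -- boundary vertex in case `p` is cut.
    by_cases hbad : s < ω v ∨ 2 ≤ (η v).card
    · obtain ⟨Y, ℓ, N, hY, hcard⟩ := ih ω (Function.update η p (insert v (η p)))
      have hvY : v ∉ Y := fun h => hv (hY.subset h)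
      have hsub : ∀ a, η a ⊆ Function.update η p (insert v (η p)) a := by
        intro a
        by_cases h : a = p
        · subst h; simp
        · simp [h]
      refine ⟨insert v Y, Function.update ℓ v v, N,
        ⟨Finset.insert_subset_insert _ hY.subset, ?_, hY.card_le, ?_, ?_, ?_, ?_⟩, ?_⟩
      · intro a ha
        by_cases h : a = v
        · subst h; simp
        · rw [Function.update_of_ne h]
          exact Finset.mem_insert_of_mem (hY.label_mem a (Finset.mem_of_mem_insert_of_ne ha h))
      · intro a ha haY
        rw [Finset.mem_insert, not_or] at haY
        rw [Function.update_of_ne haY.1]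
        exact (hsub a).trans (hY.marked a (Finset.mem_of_mem_insert_of_ne ha haY.1) haY.2)
      · intro a ha b hb hab haY hbY
        rw [Finset.mem_insert, not_or] at haY hbY
        rw [Function.update_of_ne haY.1, Function.update_of_ne hbY.1]
        exact hY.label_eq a (Finset.mem_of_mem_insert_of_ne ha haY.1) b
          (Finset.mem_of_mem_insert_of_ne hb hbY.1) hab haY.2 hbY.2
      · intro a ha b hb hab haY hbY
        rw [Finset.mem_insert, not_or] at haY
        have ha' := Finset.mem_of_mem_insert_of_ne ha haY.1
        rw [Function.update_of_ne haY.1]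
        by_cases hbv : b = v
        · subst hbv
          have := huniq a ha' hab.symm
          subst this
          exact hY.marked a ha' haY.2 (by simp)
        · exact hY.boundary a ha' b (Finset.mem_of_mem_insert_of_ne hb hbv) hab haY.2
            (Finset.mem_of_mem_insert_of_ne hbY hbv)
      · intro c
        refine le_trans (Finset.sum_le_sum_of_subset ?_) (hY.weight_le c)
        intro a
        simp only [Finset.mem_filter, Finset.mem_insert, not_or]
        rintro ⟨h1, ⟨h2, h3⟩, h4⟩
        rw [Function.update_of_ne h2] at h4
        exact ⟨h1.resolve_left h2, h3, h4⟩
      · rw [Finset.card_insert_of_notMem hvY, Finset.sum_insert hv, Finset.sum_insert hv]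
        have h1 : ∑ a ∈ A, (Function.update η p (insert v (η p)) a).card ≤
            ∑ a ∈ A, (η a).card + 1 := by
          rw [← Finset.add_sum_erase _ _ hp, ← Finset.add_sum_erase _ (fun a => (η a).card) hp,
            Function.update_self]
          have := Finset.card_insert_le v (η p)
          have h2 : ∑ a ∈ A.erase p, (Function.update η p (insert v (η p)) a).card =
              ∑ a ∈ A.erase p, (η a).card := by
            refine Finset.sum_congr rfl fun a ha => ?_
            rw [Function.update_of_ne (Finset.ne_of_mem_erase ha)]
          omega
        have h2 := Nat.mul_le_mul_left (s + 1) h1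
        rcases hbad with h | h <;> nlinarith
    · push Not at hbad
      obtain ⟨Y, ℓ, N, hY, hcard⟩ :=
        ih (Function.update ω p (ω p + ω v)) (Function.update η p (η p ∪ η v))
      have hvY : v ∉ Y := fun h => hv (hY.subset h)
      have hsub : ∀ a, η a ⊆ Function.update η p (η p ∪ η v) a := by
        intro a
        by_cases h : a = p
        · subst h; simp
        · simp [h]
      have hle : ∀ a, ω a ≤ Function.update ω p (ω p + ω v) a := by
        intro a
        by_cases h : a = p
        · subst h; simp
        · simp [h]
      have hbound : (s + 1) * Y.card ≤ 2 * ∑ a ∈ insert v A, ω a +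
          (s + 1) * ∑ a ∈ insert v A, (η a).card := by
        rw [Finset.sum_insert hv, Finset.sum_insert hv]
        have h1 : ∑ a ∈ A, (Function.update η p (η p ∪ η v) a).card ≤
            ∑ a ∈ A, (η a).card + (η v).card := by
          rw [← Finset.add_sum_erase _ _ hp, ← Finset.add_sum_erase _ (fun a => (η a).card) hp,
            Function.update_self]
          have := Finset.card_union_le (η p) (η v)
          have h2 : ∑ a ∈ A.erase p, (Function.update η p (η p ∪ η v) a).card =
              ∑ a ∈ A.erase p, (η a).card := by
            refine Finset.sum_congr rfl fun a ha => ?_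
            rw [Function.update_of_ne (Finset.ne_of_mem_erase ha)]
          omega
        have h2 : ∑ a ∈ A, Function.update ω p (ω p + ω v) a = ∑ a ∈ A, ω a + ω v := by
          rw [← Finset.add_sum_erase _ _ hp, ← Finset.add_sum_erase _ ω hp,
            Function.update_self]
          have h2 : ∑ a ∈ A.erase p, Function.update ω p (ω p + ω v) a =
              ∑ a ∈ A.erase p, ω a := by
            refine Finset.sum_congr rfl fun a ha => ?_
            rw [Function.update_of_ne (Finset.ne_of_mem_erase ha)]
          omega
        have h3 := Nat.mul_le_mul_left (s + 1) h1
        rw [h2] at hcard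
        nlinarith
      by_cases hpY : p ∈ Y
      -- The parent is cut, so the class of `v` is complete and becomes a new class labelled `v`.
      · refine ⟨Y, Function.update ℓ v v, Function.update N v (insert p (η v)),
          ⟨hY.subset.trans (Finset.subset_insert _ _), ?_, ?_, ?_, ?_, ?_, ?_⟩, hbound⟩
        · intro a ha
          by_cases h : a = v
          · subst h; simp
          · rw [Function.update_of_ne h]
            exact Finset.mem_insert_of_mem (hY.label_mem a (Finset.mem_of_mem_insert_of_ne ha h))
        · intro c
          by_cases h : c = v
          · subst h
            rw [Function.update_self]
            have := Finset.card_insert_le p (η c)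
            omega
          · rw [Function.update_of_ne h]; exact hY.card_le c
        · intro a ha haY
          by_cases h : a = v
          · subst h
            simp
          · have ha' := Finset.mem_of_mem_insert_of_ne ha h
            have hl : ℓ a ≠ v := fun hh => hv (hh ▸ hY.label_mem a ha')
            rw [Function.update_of_ne h, Function.update_of_ne hl]
            exact (hsub a).trans (hY.marked a ha' haY)
        · intro a ha b hb hab haY hbY
          have hav : a ≠ v := by
            rintro rfl
            have hb' := Finset.mem_of_mem_insert_of_ne hb hab.ne'
            exact hbY (huniq b hb' hab ▸ hpY)
          have hbv : b ≠ v := by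
            rintro rfl
            have ha' := Finset.mem_of_mem_insert_of_ne ha hab.ne
            exact haY (huniq a ha' hab.symm ▸ hpY)
          rw [Function.update_of_ne hav, Function.update_of_ne hbv]
          exact hY.label_eq a (Finset.mem_of_mem_insert_of_ne ha hav) b
            (Finset.mem_of_mem_insert_of_ne hb hbv) hab haY hbY
        · intro a ha b hb hab haY hbY
          have hbA := hY.subset hbY
          by_cases h : a = v
          · subst h
            rw [huniq b hbA hab]
            simp
          · have ha' := Finset.mem_of_mem_insert_of_ne ha h
            have hl : ℓ a ≠ v := fun hh => hv (hh ▸ hY.label_mem a ha')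
            rw [Function.update_of_ne h, Function.update_of_ne hl]
            exact hY.boundary a ha' b hbA hab haY hbY
        · intro c
          by_cases h : c = v
          · subst h
            refine le_trans (Finset.sum_le_sum_of_subset (t := {c}) ?_) (by simpa using hbad.1)
            intro a
            simp only [Finset.mem_filter, Finset.mem_insert, Finset.mem_singleton]
            rintro ⟨h1, -, h3⟩
            by_contra hac
            rw [Function.update_of_ne hac] at h3
            exact hv (h3 ▸ hY.label_mem a (h1.resolve_left hac))
          · refine le_trans ?_ (hY.weight_le c)
            refine le_trans (Finset.sum_le_sum_of_subset ?_) (Finset.sum_le_sum fun a _ => hle a)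
            intro a
            simp only [Finset.mem_filter, Finset.mem_insert]
            rintro ⟨h1, h2, h3⟩
            have hav : a ≠ v := by
              rintro rfl
              exact h (by simpa using h3.symm)
            rw [Function.update_of_ne hav] at h3
            exact ⟨h1.resolve_left hav, h2, h3⟩
      -- The parent survives and `v` joins its class; the weight and marks of `v` were already
      -- charged to `p`.
      · refine ⟨Y, Function.update ℓ v (ℓ p), N,
          ⟨hY.subset.trans (Finset.subset_insert _ _), ?_, hY.card_le, ?_, ?_, ?_, ?_⟩, hbound⟩
        · intro a ha
          by_cases h : a = v
          · subst h
            simpa using Or.inr (hY.label_mem p hp)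
          · rw [Function.update_of_ne h]
            exact Finset.mem_insert_of_mem (hY.label_mem a (Finset.mem_of_mem_insert_of_ne ha h))
        · intro a ha haY
          by_cases h : a = v
          · subst h
            have := hY.marked p hp hpY
            rw [Function.update_self] at this ⊢
            exact Finset.subset_union_right.trans this
          · rw [Function.update_of_ne h]
            exact (hsub a).trans (hY.marked a (Finset.mem_of_mem_insert_of_ne ha h) haY)
        · intro a ha b hb hab haY hbY
          by_cases hav : a = v
          · subst hav
            have hb' := Finset.mem_of_mem_insert_of_ne hb hab.ne'
            rw [Function.update_self, Function.update_of_ne hab.ne', huniq b hb' hab]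
          by_cases hbv : b = v
          · subst hbv
            have ha' := Finset.mem_of_mem_insert_of_ne ha hab.ne
            rw [Function.update_self, Function.update_of_ne hab.ne, huniq a ha' hab.symm]
          rw [Function.update_of_ne hav, Function.update_of_ne hbv]
          exact hY.label_eq a (Finset.mem_of_mem_insert_of_ne ha hav) b
            (Finset.mem_of_mem_insert_of_ne hb hbv) hab haY hbY
        · intro a ha b hb hab haY hbY
          have hbA := hY.subset hbY
          by_cases h : a = v
          · subst h
            exact absurd (huniq b hbA hab ▸ hbY) hpY
          · rw [Function.update_of_ne h]
            exact hY.boundary a (Finset.mem_of_mem_insert_of_ne ha h) b hbA hab haY hbY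
        · intro c
          by_cases h : ℓ p = c
          · subst h
            have hpf : p ∈ A.filter fun a => a ∉ Y ∧ ℓ a = ℓ p := by simp [hp, hpY]
            have hvf : v ∉ A.filter fun a => a ∉ Y ∧ ℓ a = ℓ p := by simp [hv]
            have hset : (insert v A).filter
                (fun a => a ∉ Y ∧ Function.update ℓ v (ℓ p) a = ℓ p) =
                insert v (A.filter fun a => a ∉ Y ∧ ℓ a = ℓ p) := by
              ext a
              by_cases hav : a = v
              · subst hav; simp [hvY]
              · simp [hav]
            have h2 := hY.weight_le (ℓ p)
            rw [← Finset.add_sum_erase _ _ hpf, Function.update_self] at h2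
            rw [hset, Finset.sum_insert hvf, ← Finset.add_sum_erase _ _ hpf]
            have h3 : ∑ a ∈ (A.filter fun a => a ∉ Y ∧ ℓ a = ℓ p).erase p, ω a ≤
                ∑ a ∈ (A.filter fun a => a ∉ Y ∧ ℓ a = ℓ p).erase p,
                  Function.update ω p (ω p + ω v) a := Finset.sum_le_sum fun a _ => hle a
            omega
          · refine le_trans ?_ (hY.weight_le c)
            refine le_trans (Finset.sum_le_sum_of_subset ?_) (Finset.sum_le_sum fun a _ => hle a)
            intro a
            simp only [Finset.mem_filter, Finset.mem_insert]
            rintro ⟨h1, h2, h3⟩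
            have hav : a ≠ v := by
              rintro rfl
              exact h (by simpa using h3)
            rw [Function.update_of_ne hav] at h3
            exact ⟨h1.resolve_left hav, h2, h3⟩

end TreePartition

/-! ### Separators and distances -/

section Separation

variable {V : Type*} {G : SimpleGraph V}

theorem walkLength_append {w : Sym2 V → ℝ≥0∞} {u v x : V} (p : G.Walk u v) (q : G.Walk v x) :
    walkLength w (p.append q) = walkLength w p + walkLength w q := by
  simp [walkLength, SimpleGraph.Walk.edges_append]

theorem walkLength_cons {w : Sym2 V → ℝ≥0∞} {u v x : V} (h : G.Adj u v) (q : G.Walk v x) :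
    walkLength w (.cons h q) = w s(u, v) + walkLength w q := by
  simp [walkLength]

theorem wDist_le_walkLength (w : Sym2 V → ℝ≥0∞) {u v : V} (p : G.Walk u v) :
    wDist G w u v ≤ walkLength w p := iInf_le _ p

theorem wDist_self (w : Sym2 V → ℝ≥0∞) (u : V) : wDist G w u u = 0 :=
  le_antisymm ((wDist_le_walkLength w .nil).trans (by simp [walkLength])) zero_le

theorem wDist_triangle (w : Sym2 V → ℝ≥0∞) (u v x : V) :
    wDist G w u x ≤ wDist G w u v + wDist G w v x := by
  unfold wDist
  rw [ENNReal.iInf_add]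
  refine le_iInf fun p => ?_
  rw [ENNReal.add_iInf]
  refine le_iInf fun q => ?_
  exact (iInf_le _ (p.append q)).trans (walkLength_append p q).le

/-- If every walk from `u` to `v` meets the finite set `Z`, then some vertex of `Z` lies between
`u` and `v` with respect to the shortest-path distance. -/
theorem exists_wDist_add_eq (w : Sym2 V → ℝ≥0∞) {u v : V} (Z : Finset V)
    (hZ : ∀ p : G.Walk u v, ∃ x ∈ Z, x ∈ p.support) (hd : wDist G w u v ≠ ⊤) :
    ∃ x ∈ Z, wDist G w u x + wDist G w x v = wDist G w u v := by
  classical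
  have hne : Nonempty (G.Walk u v) := by
    by_contra h
    rw [not_nonempty_iff] at h
    exact hd (iInf_of_empty _)
  obtain ⟨p₀⟩ := hne
  obtain ⟨x₀, hx₀, -⟩ := hZ p₀
  -- Minimising over the finite set `Z` avoids having to know that a shortest walk exists.
  obtain ⟨x, hx, hmin⟩ := Z.exists_min_image (fun x => wDist G w u x + wDist G w x v) ⟨x₀, hx₀⟩
  refine ⟨x, hx, le_antisymm (le_iInf fun p => ?_) (wDist_triangle w u x v)⟩
  obtain ⟨y, hy, hyp⟩ := hZ p
  refine (hmin y hy).trans ?_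
  conv_rhs => rw [← p.take_spec hyp, walkLength_append]
  exact add_le_add (wDist_le_walkLength w _) (wDist_le_walkLength w _)

variable {m : ℕ} {T : SimpleGraph (Fin m)} {bag : Fin m → Finset V}

/-- A vertex whose bags lie both inside and outside of `L` is in a bag on the boundary of `L`. -/
theorem IsTreeDecomposition.exists_boundary (hT : IsTreeDecomposition G T bag)
    (L : Set (Fin m)) {u : V} {i j : Fin m} (hi : u ∈ bag i) (hiL : i ∈ L) (hj : u ∈ bag j)
    (hjL : j ∉ L) : ∃ a ∈ L, ∃ b ∉ L, T.Adj a b ∧ u ∈ bag a ∧ u ∈ bag b := by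
  obtain ⟨q⟩ := (hT.subtree u).preconnected ⟨i, hi⟩ ⟨j, hj⟩
  obtain ⟨e, -, he1, he2⟩ := q.exists_boundary_dart (Subtype.val ⁻¹' L) hiL hjL
  exact ⟨e.fst, he1, e.snd, he2, e.adj, e.fst.2, e.snd.2⟩

/-- The first vertex of the walk with a bag outside `L` shares a bag in `L` with its predecessor, so
its subtree crosses the boundary of `L` and it lies in `Z`. -/
theorem IsTreeDecomposition.exists_mem_support (hT : IsTreeDecomposition G T bag)
    (L : Set (Fin m)) (Z : Finset V) (hZ : ∀ a ∈ L, ∀ b ∉ L, T.Adj a b → bag b ⊆ Z)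
    {u v : V} (hu : ∀ i, u ∈ bag i → i ∈ L) (hv : ∃ i ∉ L, v ∈ bag i) (p : G.Walk u v) :
    ∃ x ∈ Z, x ∈ p.support := by
  induction p with
  | nil =>
    obtain ⟨i, hi, hvi⟩ := hv
    exact absurd (hu i hvi) hi
  | @cons u x v hadj p ih =>
    by_cases hx : ∀ i, x ∈ bag i → i ∈ L
    · obtain ⟨y, hy, hyp⟩ := ih hx hv
      exact ⟨y, hy, by simp [hyp]⟩
    · push Not at hx
      obtain ⟨i, hxi, hiL⟩ := hx
      obtain ⟨j, huj, hxj⟩ := hT.edge_mem u x hadj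
      obtain ⟨a, ha, b, hb, hab, -, hxb⟩ := hT.exists_boundary L hxj (hu j huj) hxi hiL
      exact ⟨x, hZ a ha b hb hab hxb, by simp⟩

end Separation

/-! ### Vertices joined by few hops -/

section Hops

variable {V : Type*} {G : SimpleGraph V} {w : Sym2 V → ℝ≥0∞} {E E' : Set (Sym2 V)}

/-- The shortest-path distance as a weight function on pairs of vertices. -/
noncomputable def distWeight (G : SimpleGraph V) (w : Sym2 V → ℝ≥0∞) : Sym2 V → ℝ≥0∞ :=
  Sym2.lift ⟨fun u v => wDist G w u v, fun u v => wDist_comm G w u v⟩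

/-- `u` and `v` are joined by at most `h` edges of `E` whose total length is at most the distance
of `u` and `v`. -/
def Joined (G : SimpleGraph V) (w : Sym2 V → ℝ≥0∞) (E : Set (Sym2 V)) (h : ℕ) (u v : V) : Prop :=
  ∃ p : (SimpleGraph.fromEdgeSet E).Walk u v, p.length ≤ h ∧
    walkLength (distWeight G w) p ≤ wDist G w u v

theorem Joined.refl (h : ℕ) (u : V) : Joined G w E h u u :=
  ⟨.nil, by simp, by simp [walkLength]⟩

theorem Joined.of_mem {u v : V} (huv : s(u, v) ∈ E) : Joined G w E 1 u v := by
  by_cases h : u = v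
  · subst h; exact .refl _ _
  · exact ⟨.cons ((SimpleGraph.fromEdgeSet_adj E).2 ⟨huv, h⟩) .nil, by simp,
      by simp [walkLength, distWeight]⟩

theorem Joined.symm {h : ℕ} {u v : V} (H : Joined G w E h u v) : Joined G w E h v u := by
  obtain ⟨p, hp, hl⟩ := H
  refine ⟨p.reverse, by simpa using hp, ?_⟩
  rw [wDist_comm]
  simpa [walkLength, SimpleGraph.Walk.edges_reverse, List.sum_reverse] using hl

theorem Joined.trans {h k : ℕ} {u x v : V} (H : Joined G w E h u x) (K : Joined G w E k x v)
    (hd : wDist G w u x + wDist G w x v = wDist G w u v) : Joined G w E (h + k) u v := by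
  obtain ⟨p, hp, hpl⟩ := H
  obtain ⟨q, hq, hql⟩ := K
  refine ⟨p.append q, by rw [SimpleGraph.Walk.length_append]; omega, ?_⟩
  rw [walkLength_append, ← hd]
  exact add_le_add hpl hql

theorem Joined.mono {h k : ℕ} {u v : V} (hhk : h ≤ k) (hE : E ⊆ E') (H : Joined G w E h u v) :
    Joined G w E' k u v := by
  obtain ⟨p, hp, hl⟩ := H
  refine ⟨p.mapLe (SimpleGraph.fromEdgeSet_mono hE), by simpa using hp.trans hhk, ?_⟩
  rwa [walkLength, SimpleGraph.Walk.edges_mapLe_eq_edges]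

/-- All pairs of vertices of `S` at finite distance are joined by `h` edges of `E`. -/
def JoinsAll (G : SimpleGraph V) (w : Sym2 V → ℝ≥0∞) (E : Set (Sym2 V)) (h : ℕ)
    (S : Finset V) : Prop :=
  ∀ u ∈ S, ∀ v ∈ S, wDist G w u v ≠ ⊤ → Joined G w E h u v

theorem exists_clique (S : Finset V) : ∃ E : Finset (Sym2 V), E.card ≤ S.card * S.card ∧
    ∀ h, 1 ≤ h → JoinsAll G w E h S := by
  classical
  refine ⟨(S ×ˢ S).image fun p => s(p.1, p.2), ?_, ?_⟩
  · exact Finset.card_image_le.trans (Finset.card_product S S).le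
  · intro h hh u hu v hv _
    refine (Joined.of_mem ?_).mono hh subset_rfl
    exact Finset.mem_coe.2 (Finset.mem_image.2 ⟨(u, v), by simp [hu, hv], rfl⟩)

end Hops

/-! ### Cutting a graph of small treewidth into pieces -/

section Cut

variable {V : Type*} {G : SimpleGraph V} {w : Sym2 V → ℝ≥0∞}

/-- Removing `X` splits `S` into pieces (the fibres of `part`) with at most `s` elements, and the
piece with label `c` is separated from everything else by the small set `Q c`. -/
structure IsCut (G : SimpleGraph V) (w : Sym2 V → ℝ≥0∞) {m : ℕ} (b : ℕ) (S : Finset V) (s : ℕ)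
    (X : Finset V) (part : V → Fin m) (Q : Fin m → Finset V) : Prop where
  card_mul_le : (s + 1) * X.card ≤ 2 * b * S.card
  card_le : ∀ c, (Q c).card ≤ 2 * b
  subset : ∀ c, Q c ⊆ X
  piece_le : ∀ c, ∀ S' ⊆ S, (∀ u ∈ S', u ∉ X ∧ part u = c) → S'.card ≤ s
  separates : ∀ u ∉ X, ∀ v, (v ∈ X ∨ part v ≠ part u) → wDist G w u v ≠ ⊤ →
    ∃ x ∈ Q (part u), wDist G w u x + wDist G w x v = wDist G w u v

/-- Each vertex of `S` is charged to one chosen node containing it, and the tree is partitioned with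
these weights. `X` is the union of the bags at the cut nodes, and `Q c` the union of the at most two
bags bordering class `c`. -/
theorem IsTreeDecomposition.exists_isCut {m : ℕ} {T : SimpleGraph (Fin m)}
    {bag : Fin m → Finset V} (hT : IsTreeDecomposition G T bag) {b : ℕ}
    (hbag : ∀ i, (bag i).card ≤ b) (S : Finset V) (s : ℕ) :
    ∃ X part, ∃ Q : Fin m → Finset V, IsCut G w b S s X part Q := by
  classical
  have hnode : ∀ u, ∃ i, u ∈ bag i := fun u =>
    have ⟨i⟩ := (hT.subtree u).nonempty
    ⟨i.1, i.2⟩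
  choose node hnode using hnode
  obtain ⟨Y, ℓ, N, hY, hcard⟩ := exists_isPartition (peelable_univ hT.isTree) s
    (fun a => (S.filter fun u => node u = a).card) (fun _ => ∅)
  have hsum : ∑ a, (S.filter fun u => node u = a).card = S.card :=
    (Finset.card_eq_sum_card_fiberwise fun _ _ => Finset.mem_coe.2 (Finset.mem_univ _)).symm
  rw [hsum] at hcard
  simp only [Finset.card_empty, Finset.sum_const_zero, mul_zero, add_zero] at hcard
  have hunion : ∀ Z : Finset (Fin m), (Z.biUnion bag).card ≤ Z.card * b := fun Z =>
    Finset.card_biUnion_le_card_mul _ _ _ fun i _ => hbag i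
  refine ⟨Y.biUnion bag, fun u => ℓ (node u), fun c => (N c ∩ Y).biUnion bag,
    ?_, ?_, ?_, ?_, ?_⟩
  · calc (s + 1) * (Y.biUnion bag).card ≤ (s + 1) * (Y.card * b) :=
          Nat.mul_le_mul_left _ (hunion Y)
      _ = ((s + 1) * Y.card) * b := by ring
      _ ≤ (2 * S.card) * b := Nat.mul_le_mul_right _ hcard
      _ = 2 * b * S.card := by ring
  · intro c
    refine (hunion _).trans (Nat.mul_le_mul_right _ ?_)
    exact (Finset.card_le_card Finset.inter_subset_left).trans (hY.card_le c)
  · intro c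
    exact Finset.biUnion_subset_biUnion_of_subset_left _ Finset.inter_subset_right
  · intro c S' hS' hc
    refine le_trans ?_ (hY.weight_le c)
    rw [Finset.card_eq_sum_card_fiberwise (s := S') (f := node)
      (t := Finset.univ.filter fun a => a ∉ Y ∧ ℓ a = c)]
    · refine Finset.sum_le_sum fun a _ => Finset.card_le_card ?_
      exact Finset.filter_subset_filter _ hS'
    · intro u hu
      have hu := hc u hu
      simp only [Finset.coe_filter, Set.mem_ofPred_eq, Finset.mem_univ, true_and]
      exact ⟨fun h => hu.1 (Finset.mem_biUnion.2 ⟨_, h, hnode u⟩), hu.2⟩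
  · intro u hu v hv hd
    have hu : ∀ i ∈ Y, u ∉ bag i := by simpa using hu
    set L : Set (Fin m) := {a | a ∉ Y ∧ ℓ a = ℓ (node u)} with hL
    -- Leaving the class means entering a cut node, whose bag lies in `X` and so misses `u`.
    have huL : ∀ i, u ∈ bag i → i ∈ L := by
      intro i hi
      by_contra hiL
      obtain ⟨a, ha, c, hc, hac, -, huc⟩ := hT.exists_boundary L (hnode u)
        ⟨fun h => hu _ h (hnode u), rfl⟩ hi hiL
      have hcY : c ∉ Y := fun h => hu _ h huc
      refine hc ⟨hcY, ?_⟩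
      rw [← ha.2]
      exact (hY.label_eq a (Finset.mem_univ _) c (Finset.mem_univ _) hac ha.1 hcY).symm
    have hvL : ∃ i ∉ L, v ∈ bag i := by
      rcases hv with hv | hv
      · obtain ⟨i, hi, hvi⟩ := Finset.mem_biUnion.1 hv
        exact ⟨i, fun h => h.1 hi, hvi⟩
      · exact ⟨node v, fun h => hv h.2, hnode v⟩
    refine exists_wDist_add_eq w _ (hT.exists_mem_support L _ ?_ huL hvL) hd
    intro a ha c hc hac
    have hcY : c ∈ Y := by
      by_contra hcY
      refine hc ⟨hcY, ?_⟩
      rw [← ha.2]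
      exact (hY.label_eq a (Finset.mem_univ _) c (Finset.mem_univ _) hac ha.1 hcY).symm
    refine Finset.subset_biUnion_of_mem bag (Finset.mem_inter.2 ⟨?_, hcY⟩)
    rw [← ha.2]
    exact hY.boundary a (Finset.mem_univ _) c (Finset.mem_univ _) hac ha.1 hcY

variable {m b s : ℕ} {S X : Finset V} {part : V → Fin m} {Q : Fin m → Finset V}

/-- All pairs of vertices of `S` that are not in the same piece are joined by `h` edges. -/
def JoinsAcross (G : SimpleGraph V) (w : Sym2 V → ℝ≥0∞) (E : Set (Sym2 V)) (h : ℕ)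
    (S X : Finset V) (part : V → Fin m) : Prop :=
  ∀ u ∈ S, ∀ v ∈ S, (u ∈ X ∨ v ∈ X ∨ part u ≠ part v) → wDist G w u v ≠ ⊤ → Joined G w E h u v

theorem IsCut.exists_between (hc : IsCut G w b S s X part Q) {u v : V}
    (huv : u ∈ X ∨ v ∈ X ∨ part u ≠ part v) (hd : wDist G w u v ≠ ⊤) :
    ∃ x ∈ X, (x = u ∨ x ∈ Q (part u)) ∧ wDist G w u x + wDist G w x v = wDist G w u v := by
  by_cases hu : u ∈ X
  · exact ⟨u, hu, .inl rfl, by simp [wDist_self]⟩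
  · obtain ⟨x, hx, h⟩ := hc.separates u hu v ((huv.resolve_left hu).imp_right Ne.symm) hd
    exact ⟨x, hc.subset _ hx, .inr hx, h⟩

/-- The route is `u, x, …, y, v` with `x` in the separator of `u` (or `x = u`), `y` likewise for
`v`, and `k` hops from `x` to `y` inside `X`. Here `y` is chosen between `v` and `x`, so that the
distances add up. -/
theorem IsCut.exists_joinsAcross (hc : IsCut G w b S s X part Q) {k : ℕ} {E : Finset (Sym2 V)}
    (hE : JoinsAll G w E k X) : ∃ E' : Finset (Sym2 V),
      E'.card ≤ E.card + 2 * b * S.card ∧ JoinsAcross G w E' (k + 2) S X part := by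
  classical
  set F := S.biUnion fun u => (Q (part u)).image fun x => s(u, x) with hF
  have hFc : F.card ≤ S.card * (2 * b) := Finset.card_biUnion_le_card_mul _ _ _ fun u _ =>
    Finset.card_image_le.trans (hc.card_le _)
  have hmem : ∀ u ∈ S, ∀ x, (x = u ∨ x ∈ Q (part u)) →
      Joined G w ((E ∪ F : Finset (Sym2 V)) : Set (Sym2 V)) 1 u x := by
    rintro u hu x (rfl | hx)
    · exact .refl _ _
    · refine .of_mem (Finset.mem_coe.2 (Finset.mem_union_right _ (Finset.mem_biUnion.2
        ⟨u, hu, Finset.mem_image.2 ⟨x, hx, rfl⟩⟩)))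
  refine ⟨E ∪ F, ?_, ?_⟩
  · have := Finset.card_union_le E F
    nlinarith
  · intro u hu v hv huv hd
    obtain ⟨x, hxX, hx, hux⟩ := hc.exists_between huv hd
    have hxv : wDist G w x v ≠ ⊤ := by
      rw [← hux] at hd
      exact (ENNReal.add_ne_top.1 hd).2
    have hvx : wDist G w v x ≠ ⊤ := wDist_comm G w x v ▸ hxv
    obtain ⟨y, hyX, hy, hvy⟩ := hc.exists_between (.inr (.inl hxX)) hvx
    have hxy : wDist G w x y ≠ ⊤ := by
      rw [← hvy] at hvx
      exact wDist_comm G w y x ▸ (ENNReal.add_ne_top.1 hvx).2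
    have h1 := (hE x hxX y hyX hxy).mono le_rfl
      (E' := ((E ∪ F : Finset (Sym2 V)) : Set (Sym2 V)))
      (Finset.coe_subset.2 Finset.subset_union_left)
    have h2 := (hmem v hv y hy).trans h1.symm hvy
    exact ((hmem u hu x hx).trans h2.symm hux).mono (by omega) subset_rfl

theorem IsCut.exists_joinsAcross_two (hc : IsCut G w b S s X part Q) :
    ∃ E : Finset (Sym2 V), E.card ≤ S.card * X.card ∧ JoinsAcross G w E 2 S X part := by
  classical
  refine ⟨(S ×ˢ X).image fun p => s(p.1, p.2), ?_, ?_⟩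
  · exact Finset.card_image_le.trans (Finset.card_product S X).le
  · intro u hu v hv huv hd
    obtain ⟨x, hxX, -, hux⟩ := hc.exists_between huv hd
    have hmem : ∀ a ∈ S, Joined G w
        (((S ×ˢ X).image fun p => s(p.1, p.2) : Finset (Sym2 V)) : Set (Sym2 V)) 1 a x :=
      fun a ha => .of_mem (Finset.mem_coe.2 (Finset.mem_image.2 ⟨(a, x), by simp [ha, hxX], rfl⟩))
    exact (hmem u hu).trans (hmem v hv).symm hux

/-- The pieces are disjoint, so the linear bounds for them add up to `K * S.card`. -/
theorem IsCut.exists_joinsAll (hc : IsCut G w b S s X part Q) {h K : ℕ} {E₀ : Finset (Sym2 V)}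
    (hE₀ : JoinsAcross G w E₀ h S X part)
    (hrec : ∀ S' : Finset V, S'.card ≤ s →
      ∃ E : Finset (Sym2 V), E.card ≤ K * S'.card ∧ JoinsAll G w E h S') :
    ∃ E : Finset (Sym2 V), E.card ≤ E₀.card + K * S.card ∧ JoinsAll G w E h S := by
  classical
  have hpiece : ∀ c : Fin m, (S.filter fun u => u ∉ X ∧ part u = c).card ≤ s :=
    fun c => hc.piece_le c _ (Finset.filter_subset _ _) fun u hu => (Finset.mem_filter.1 hu).2
  choose E hEc hE using fun c => hrec _ (hpiece c)
  refine ⟨E₀ ∪ Finset.univ.biUnion E, ?_, ?_⟩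
  · have h1 : (Finset.univ.biUnion E).card ≤ K * S.card := by
      calc (Finset.univ.biUnion E).card ≤ ∑ c, (E c).card := Finset.card_biUnion_le
        _ ≤ ∑ c, K * (S.filter fun u => part u = c).card := by
            refine Finset.sum_le_sum fun c _ => (hEc c).trans (Nat.mul_le_mul_left _ ?_)
            exact Finset.card_le_card fun u hu => by
              simp only [Finset.mem_filter] at hu ⊢
              exact ⟨hu.1, hu.2.2⟩
        _ = K * S.card := by
            rw [← Finset.mul_sum, ← Finset.card_eq_sum_card_fiberwise
              fun _ _ => Finset.mem_coe.2 (Finset.mem_univ _)]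
    exact (Finset.card_union_le _ _).trans (Nat.add_le_add_left h1 _)
  · intro u hu v hv hd
    by_cases huv : u ∈ X ∨ v ∈ X ∨ part u ≠ part v
    · exact (hE₀ u hu v hv huv hd).mono le_rfl (Finset.coe_subset.2 Finset.subset_union_left)
    · push Not at huv
      obtain ⟨huX, hvX, hpart⟩ := huv
      refine (hE (part u) u (by simp [hu, huX]) v (by simp [hv, hvX, hpart]) hd).mono le_rfl
        (Finset.coe_subset.2 ?_)
      exact (Finset.subset_biUnion_of_mem E (Finset.mem_univ _)).trans Finset.subset_union_right

end Cut

/-! ### The recursion along the rows of the Ackermann functions -/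

/-- The rows of `ackA` and `ackB`, interleaved. -/
def rowAck (h j : ℕ) : ℕ := if h % 2 = 0 then ackA (h / 2) j else ackB (h / 2) j

theorem rowAck_zero (j : ℕ) : rowAck 0 j = 2 * j := by simp [rowAck, ackA]

theorem rowAck_one (j : ℕ) : rowAck 1 j = j ^ 2 := by simp [rowAck, ackB]

theorem rowAck_add_two_zero (h : ℕ) : 1 ≤ rowAck (h + 2) 0 ∧ rowAck (h + 2) 0 ≤ 2 := by
  simp only [rowAck, Nat.add_mod_right, Nat.add_div_right h two_pos]
  split_ifs <;> simp [ackA, ackB]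

theorem rowAck_add_two_succ (h j : ℕ) :
    rowAck (h + 2) (j + 1) = rowAck h (rowAck (h + 2) j) := by
  simp only [rowAck, Nat.add_mod_right, Nat.add_div_right h two_pos]
  split_ifs <;> simp [ackA, ackB]

theorem rowAck_add_two_pos (h j : ℕ) : 1 ≤ rowAck (h + 2) j := by
  simp only [rowAck, Nat.add_mod_right, Nat.add_div_right h two_pos]
  split_ifs
  · have := lt_ackA (h / 2 + 1) j (.inl (by omega)); omega
  · have := lt_ackB (h / 2 + 1) j (.inl (by omega)); omega

theorem le_rowAck_rowInvAck (h n : ℕ) : n ≤ rowAck h (rowInvAck h n) := by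
  unfold rowAck rowInvAck
  split_ifs
  · exact Nat.find_spec (exists_le_ackA (h / 2) n)
  · exact Nat.find_spec (exists_le_ackB (h / 2) n)

theorem one_le_rowInvAck {h n : ℕ} (hh : 2 ≤ h) (hn : 3 ≤ n) : 1 ≤ rowInvAck h n := by
  by_contra h0
  have h1 := le_rowAck_rowInvAck h n
  obtain ⟨k, rfl⟩ : ∃ k, h = k + 2 := ⟨h - 2, by omega⟩
  rw [show rowInvAck (k + 2) n = 0 by omega] at h1
  have := (rowAck_add_two_zero k).2
  omega

theorem ackA_strictMono (i : ℕ) : StrictMono (ackA i) := by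
  cases i with
  | zero => intro a b h; simp only [ackA]; omega
  | succ i =>
    refine strictMono_nat_of_lt_succ fun j => ?_
    have h1 := lt_ackA (i + 1) j (.inl (by omega))
    rw [ackA]
    exact lt_ackA i _ (.inr (by omega))

theorem ackA_one (i : ℕ) : ackA i 1 = 2 := by
  induction i with
  | zero => simp [ackA]
  | succ i ih => rw [ackA, ackA, ih]

theorem ackA_two (i : ℕ) : ackA i 2 = 4 := by
  induction i with
  | zero => simp [ackA]
  | succ i ih => rw [ackA, ackA_one, ih]

theorem le_ackA_four (i : ℕ) : i ≤ ackA i 4 := by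
  induction i with
  | zero => omega
  | succ i ih =>
    have h3 : ackA (i + 1) 3 = ackA i 4 := by rw [ackA, ackA_two]
    have h4 : ackA (i + 1) 3 < ackA (i + 1) 4 := ackA_strictMono _ (by omega)
    omega

/-- `A(α+1, 4) = A(α, A(α, 4)) ≥ A(α, α) ≥ n`, as `A(α, 4) ≥ α`. -/
theorem le_rowAck_four (n : ℕ) : n ≤ rowAck (2 * (invAck n + 1)) 4 := by
  set a := invAck n with ha
  have hn : n ≤ ackA a a := Nat.find_spec (exists_le_ackA_diag n)
  have h3 : ackA (a + 1) 3 = ackA a 4 := by rw [ackA, ackA_two]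
  have h4 : ackA (a + 1) 4 = ackA a (ackA a 4) := by rw [ackA, h3]
  have h5 : rowAck (2 * (a + 1)) 4 = ackA (a + 1) 4 := by simp [rowAck]
  rw [h5, h4]
  exact hn.trans ((ackA_strictMono a).monotone (le_ackA_four a))

section Recursion

variable {V : Type*} {G : SimpleGraph V} {w : Sym2 V → ℝ≥0∞} {m : ℕ} {T : SimpleGraph (Fin m)}
  {bag : Fin m → Finset V} {b : ℕ}

/-- Each of the `j` recursion levels costs `16b|S|` for crossing pairs. At the bottom `|S| ≤ 16b`,
so a clique costs no more than one further level. -/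
theorem IsTreeDecomposition.exists_joinsAll_of_joinsAcross (hT : IsTreeDecomposition G T bag)
    (hbag : ∀ i, (bag i).card ≤ b) {h : ℕ}
    (hcross : ∀ (q : ℕ) (S X : Finset V) (part : V → Fin m) (Q : Fin m → Finset V), 1 ≤ q →
      S.card ≤ 8 * b * rowAck h q → IsCut G w b S (8 * b * q) X part Q →
      ∃ E : Finset (Sym2 V), E.card ≤ 16 * b * S.card ∧ JoinsAcross G w E (h + 2) S X part)
    (j : ℕ) : ∀ S : Finset V, S.card ≤ 8 * b * rowAck (h + 2) j →
      ∃ E : Finset (Sym2 V), E.card ≤ 16 * b * (j + 1) * S.card ∧ JoinsAll G w E (h + 2) S := by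
  induction j with
  | zero =>
    intro S hS
    obtain ⟨E, hEc, hE⟩ := exists_clique (G := G) (w := w) S
    refine ⟨E, hEc.trans (Nat.mul_le_mul_right _ ?_), hE _ (by omega)⟩
    have := Nat.mul_le_mul_left (8 * b) (rowAck_add_two_zero h).2
    omega
  | succ j ih =>
    intro S hS
    rw [rowAck_add_two_succ] at hS
    obtain ⟨X, part, Q, hc⟩ :=
      hT.exists_isCut (w := w) hbag S (8 * b * rowAck (h + 2) j)
    obtain ⟨E₀, hE₀c, hE₀⟩ := hcross _ S X part Q (rowAck_add_two_pos h j) hS hc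
    obtain ⟨E, hEc, hE⟩ := hc.exists_joinsAll hE₀ ih
    exact ⟨E, hEc.trans (by nlinarith), hE⟩

theorem IsCut.four_mul_card_le {S X : Finset V} {part : V → Fin m} {Q : Fin m → Finset V} {q : ℕ}
    (hb : 1 ≤ b) (hc : IsCut G w b S (8 * b * q) X part Q) : 4 * q * X.card ≤ S.card := by
  have h1 := hc.card_mul_le
  have h2 : 2 * b * (4 * q * X.card) ≤ 2 * b * S.card := by nlinarith
  exact Nat.le_of_mul_le_mul_left h2 (by omega)

/-- The induction goes in steps of two because a crossing adds two hops; even hop numbers follow the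
rows of `A`, odd ones those of `B`. Two hops use all pairs in `S × X`, three hops a clique on `X`,
and more hops the earlier construction on `X`. -/
theorem IsTreeDecomposition.exists_joinsAll (hT : IsTreeDecomposition G T bag)
    (hbag : ∀ i, (bag i).card ≤ b) (hb : 1 ≤ b) (h : ℕ) :
    ∀ (j : ℕ) (S : Finset V), S.card ≤ 8 * b * rowAck (h + 2) j →
      ∃ E : Finset (Sym2 V), E.card ≤ 16 * b * (j + 1) * S.card ∧ JoinsAll G w E (h + 2) S := by
  induction h using Nat.twoStepInduction with
  | zero =>
    refine hT.exists_joinsAll_of_joinsAcross hbag fun q S X part Q hq hS hc => ?_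
    obtain ⟨E, hEc, hE⟩ := hc.exists_joinsAcross_two
    refine ⟨E, hEc.trans ?_, hE⟩
    rw [rowAck_zero] at hS
    have h1 := hc.card_mul_le
    have h2 : X.card ≤ 4 * b := by
      by_contra! hX
      have h3 : (8 * b * q + 1) * (4 * b + 1) ≤ 2 * b * (8 * b * (2 * q)) :=
        (Nat.mul_le_mul_left _ hX).trans (h1.trans (Nat.mul_le_mul_left _ hS))
      nlinarith
    nlinarith
  | one =>
    refine hT.exists_joinsAll_of_joinsAcross hbag fun q S X part Q hq hS hc => ?_
    obtain ⟨E, hEc, hE⟩ := exists_clique (G := G) (w := w) X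
    obtain ⟨E', hE'c, hE'⟩ := hc.exists_joinsAcross (hE 1 le_rfl)
    refine ⟨E', hE'c.trans ?_, hE'⟩
    rw [rowAck_one] at hS
    have h1 := hc.four_mul_card_le hb
    -- From `|X| ≤ |S|/(4q)` and `|S| ≤ 8bq²`, the clique has at most `b|S|/2` edges.
    have h2 : q ^ 2 * (16 * (X.card * X.card)) ≤ q ^ 2 * (8 * b * S.card) :=
      calc q ^ 2 * (16 * (X.card * X.card)) = (4 * q * X.card) * (4 * q * X.card) := by ring
        _ ≤ S.card * S.card := Nat.mul_le_mul h1 h1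
        _ ≤ 8 * b * q ^ 2 * S.card := Nat.mul_le_mul_right _ hS
        _ = q ^ 2 * (8 * b * S.card) := by ring
    have h3 := Nat.le_of_mul_le_mul_left h2 (by positivity)
    nlinarith
  | more h ih _ =>
    refine hT.exists_joinsAll_of_joinsAcross hbag fun q S X part Q hq hS hc => ?_
    have h1 := hc.four_mul_card_le hb
    have h2 : X.card ≤ S.card := by nlinarith
    -- The factor `q + 1` in the cost on `X` is absorbed by `|X| ≤ |S|/(4q)`.
    obtain ⟨E, hEc, hE⟩ := ih q X (h2.trans hS)
    obtain ⟨E', hE'c, hE'⟩ := hc.exists_joinsAcross hE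
    refine ⟨E', hE'c.trans ?_, hE'⟩
    have h3 : 16 * b * (q + 1) * X.card ≤ 8 * b * S.card :=
      calc 16 * b * (q + 1) * X.card ≤ 16 * b * (2 * q) * X.card :=
            Nat.mul_le_mul_right _ (Nat.mul_le_mul_left _ (by omega))
        _ = 8 * b * (4 * q * X.card) := by ring
        _ ≤ 8 * b * S.card := Nat.mul_le_mul_left _ h1
    nlinarith

end Recursion

/-! ### Exact hopsets -/

section Exact

variable {V : Type*} {G : SimpleGraph V} {w : Sym2 V → ℝ≥0}

theorem wDist_le_walkLength_augWeight (w : Sym2 V → ℝ≥0∞) (H : SimpleGraph V) {u v : V}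
    (p : (G ⊔ H).Walk u v) : wDist G w u v ≤ walkLength (augWeight G w H) p := by
  induction p with
  | nil => rw [wDist_self]; exact zero_le
  | @cons u x v hadj p ih =>
    rw [walkLength_cons]
    refine (wDist_triangle w u x v).trans (add_le_add ?_ ih)
    unfold augWeight
    split_ifs with hH
    · exact le_rfl
    · have hG : G.Adj u x := hadj.resolve_right hH
      exact (wDist_le_walkLength w (.cons hG .nil)).trans (by simp [walkLength])

theorem isExactHopset_of_joinsAll [Fintype V] {E : Set (Sym2 V)} {h : ℕ}
    (hE : JoinsAll G (fun e => (w e : ℝ≥0∞)) E h Finset.univ) :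
    IsExactHopset G w h (SimpleGraph.fromEdgeSet E) := by
  intro u v
  refine le_antisymm ?_ (le_iInf fun p => wDist_le_walkLength_augWeight _ _ p.1)
  by_cases hd : wDist G (fun e => (w e : ℝ≥0∞)) u v = ⊤
  · rw [hd]; exact le_top
  · obtain ⟨p, hp, hl⟩ := hE u (Finset.mem_univ _) v (Finset.mem_univ _) hd
    refine (iInf_le _ ⟨p.mapLe le_sup_right, by simpa using hp⟩).trans (le_trans (le_of_eq ?_) hl)
    simp only [walkLength, SimpleGraph.Walk.edges_mapLe_eq_edges]
    congr 1
    refine List.map_congr_left fun e he => ?_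
    unfold augWeight
    rw [if_pos (p.edges_subset_edgeSet he)]
    rfl

/-- If all walks between distinct vertices start with the edge between them, the empty hopset is
exact. -/
theorem isExactHopset_bot {h : ℕ} (hh : 1 ≤ h) (hG : ∀ u x v, u ≠ v → G.Adj u x → x = v) :
    IsExactHopset G w h ⊥ := by
  intro u v
  refine le_antisymm (le_iInf fun p => ?_)
    (le_iInf fun p => wDist_le_walkLength_augWeight _ _ p.1)
  by_cases huv : u = v
  · subst huv
    exact (iInf_le _ ⟨.nil, by simp⟩).trans (by simp [walkLength])
  · cases p with
    | nil => exact absurd rfl huv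
    | @cons _ x _ hadj p =>
      obtain rfl := hG u x v huv hadj
      refine (iInf_le _ ⟨.cons (Or.inl hadj) .nil, by simpa using hh⟩).trans ?_
      simp [walkLength, augWeight]

theorem HasTreewidthAtMost.exists_isExactHopset [Fintype V] {t : ℕ}
    (hG : HasTreewidthAtMost G t) (ht : 1 ≤ t) {h j : ℕ} (hh : 2 ≤ h)
    (hj : Fintype.card V ≤ rowAck h j) : ∃ H : SimpleGraph V, IsExactHopset G w h H ∧
      H.edgeSet.ncard ≤ 32 * t * (j + 1) * Fintype.card V := by
  obtain ⟨m, T, bag, hT, hbag⟩ := hG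
  obtain ⟨k, rfl⟩ : ∃ k, h = k + 2 := ⟨h - 2, by omega⟩
  obtain ⟨E, hEc, hE⟩ := hT.exists_joinsAll (w := fun e => (w e : ℝ≥0∞)) hbag (by omega) k j
    Finset.univ (by rw [Finset.card_univ]; nlinarith)
  refine ⟨_, isExactHopset_of_joinsAll hE, ?_⟩
  rw [SimpleGraph.edgeSet_fromEdgeSet]
  refine (Set.ncard_le_ncard Set.sdiff_subset E.finite_toSet).trans ?_
  rw [Set.ncard_coe_finset]
  refine hEc.trans ?_
  rw [Finset.card_univ]
  exact Nat.mul_le_mul_right _ (Nat.mul_le_mul_right _ (by omega))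

theorem HasTreewidthAtMost.not_adj (hG : HasTreewidthAtMost G 0) (u v : V) : ¬ G.Adj u v := by
  intro hadj
  obtain ⟨m, T, bag, hT, hbag⟩ := hG
  obtain ⟨i, hu, hv⟩ := hT.edge_mem u v hadj
  exact hadj.ne (Finset.card_le_one.1 (hbag i) u hu v hv)

end Exact

end Hopset

theorem mainTheorem5 :
    ∃ C : ℕ, ∀ (V : Type*) [Fintype V] (G : SimpleGraph V) (w : Sym2 V → ℝ≥0) (t : ℕ),
      Hopset.HasTreewidthAtMost G t →
        (∀ h : ℕ, 1 < h → ∃ H : SimpleGraph V, Hopset.IsExactHopset G w h H ∧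
          H.edgeSet.ncard ≤ C * (t * Fintype.card V * Hopset.rowInvAck h (Fintype.card V))) ∧
        (∃ H : SimpleGraph V,
          Hopset.IsExactHopset G w (2 * (Hopset.invAck (Fintype.card V) + 1)) H ∧
          H.edgeSet.ncard ≤ C * (t ^ 2 * Fintype.card V)) := by
  -- `160 = 32 · (4 + 1)`: the factor `32` comes from `16(t+1) ≤ 32t`, and `j = 4` in the second
  -- claim.
  refine ⟨160, fun V _ G w t hG => ?_⟩
  rcases Nat.eq_zero_or_pos t with rfl | ht
  · have hbot : ∀ h, 1 ≤ h → Hopset.IsExactHopset G w h ⊥ := fun h hh =>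
      Hopset.isExactHopset_bot hh fun u x v _ hadj => absurd hadj (hG.not_adj u x)
    exact ⟨fun h hh => ⟨⊥, hbot h hh.le, by simp⟩, ⊥, hbot _ (by omega), by simp⟩
  refine ⟨fun h hh => ?_, ?_⟩
  -- For `n ≤ 2` the value `λ_h(n)` may be `0`, so the hopset must be empty; with at most two
  -- vertices that is exact.
  · by_cases hn : 3 ≤ Fintype.card V
    · obtain ⟨H, hH, hc⟩ := hG.exists_isExactHopset (w := w) ht hh (Hopset.le_rowAck_rowInvAck h _)
      refine ⟨H, hH, hc.trans ?_⟩
      have h1 := Hopset.one_le_rowInvAck hh hn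
      calc 32 * t * (Hopset.rowInvAck h (Fintype.card V) + 1) * Fintype.card V
          ≤ 32 * t * (5 * Hopset.rowInvAck h (Fintype.card V)) * Fintype.card V :=
            Nat.mul_le_mul_right _ (Nat.mul_le_mul_left _ (by omega))
        _ = 160 * (t * Fintype.card V * Hopset.rowInvAck h (Fintype.card V)) := by ring
    · refine ⟨⊥, Hopset.isExactHopset_bot hh.le fun u x v huv hadj => ?_, by simp⟩
      by_contra hxv
      have h3 := (Fintype.two_lt_card_iff (α := V)).2 ⟨u, x, v, hadj.ne, huv, hxv⟩
      omega
  · obtain ⟨H, hH, hc⟩ := hG.exists_isExactHopset (w := w) ht (by omega)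
      (Hopset.le_rowAck_four (Fintype.card V))
    refine ⟨H, hH, hc.trans ?_⟩
    have h1 : t ≤ t ^ 2 := Nat.le_self_pow (by omega) t
    calc 32 * t * (4 + 1) * Fintype.card V = 160 * (t * Fintype.card V) := by ring
      _ ≤ 160 * (t ^ 2 * Fintype.card V) :=
        Nat.mul_le_mul_left _ (Nat.mul_le_mul_right _ h1)
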